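/- Let $X$ be a complex manifold of dimension $n$ and $(E,h^E)$ a holomorphic vector bundle of rank $r$ on $X$ with a smooth Hermitian metric. In a local holomorphic frame $\{e_i\}$ put $h_{i\bar k}=h^E(e_i,e_k)$; the Chern connection matrix is $\theta^j_i=\sum_k\partial h_{i\bar k}\,h^{\bar k j}$ and the Chern curvature matrix is $R=(R^j_i)$ ($j$ row, $i$ column), $R^j_i=\bar\partial\theta^j_i=\sum_{\alpha,\beta}R^j_{i\alpha\bar\beta}\,dz^\alpha\wedge d\bar z^\beta$ in local holomorphic coordinates $z^1,\dots,z^n$; put $R_{i\bar j\alpha\bar\beta}=\sum_k R^k_{i\alpha\bar\beta}h_{k\bar j}$. The bundle $(E,h^E)$ is called *Nakano positive* if at every point $\sum R_{i\bar j\alpha\bar\beta}u^{i\alpha}\overline{u^{j\beta}}>0$ for every non-zero $u=\sum u^{i\alpha}e_i\otimes\partial_\alpha\in E\otimes T^{1,0}X$, and *dual Nakano positive* if at every point $\sum R_{i\bar j\alpha\bar\beta}v^{\bar j\alpha}\overline{v^{\bar i\beta}}>0$ for every non-zero $v=\sum v^{\bar j\alpha}\bar e_j\otimes\partial_\alpha\in\overline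 E\otimes T^{1,0}X$. For an $r\times N$ matrix $A=(A_{jp})$ of $(1,0)$-forms at $x\in X$, $A_{jp}=\sum_\alpha A_{jp\alpha}dz^\alpha$, let $\mathbf A=(A_{jp\alpha})_{p,\,j\alpha}$, an $N\times rn$ matrix; for an $r\times N$ matrix $B=(B_{jp})$ of $(0,1)$-forms at $x$, $B_{jp}=\sum_\alpha B_{jp\bar\alpha}d\bar z^\alpha$, let $\mathbf B=(B_{jp\bar\alpha})_{p,\,j\alpha}$, also an $N\times rn$ matrix. By a unitary frame at $x$ we mean a holomorphic frame near $x$ with $h_{i\bar j}(x)=\delta_{ij}$. Then: 1. $(E,h^E)$ is Nakano positive if and only if for every $x\in X$ there are a unitary frame at $x$, an $N\in\mathbb N$ and an $r\times N$ matrix $B$ of $(0,1)$-forms at $x$ such that, at $x$, the Chern curvature matrix in this frame is $R=-B\wedge\overline B^{\top}$, and $\operatorname{rank}(\mathbf B)=rn$. 2. $(E,h^E)$ is dual Nakano positive if and only if for every $x\in X$ there are a unitary frame at $x$, an $N\in\mathbb N$ and an $r\times N$ matrix $A$ of $(1,0)$-forms at $x$ such that, at $x$, the Chern curvature matrix in this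 frame is $R=A\wedge\overline A^{\top}$, and $\operatorname{rank}(\mathbf A)=rn$. -/

import Mathlib

open scoped Manifold ContDiff ComplexOrder ComplexConjugate Bundle

noncomputable section

/-! ### Complex-valued forms at a point of a complex manifold

`X` is a complex manifold of dimension `n`: it is modelled on `ℂⁿ` and its transition maps are
holomorphic (`IsManifold 𝓘(ℂ, ℂⁿ) ω X`).  The tangent space `TangentSpace 𝓘(ℂ, ℂⁿ) x`, with its
complex structure, is the real tangent space `T_x X` with its almost complex structure; it is
identified with `T_x^{1,0} X` in the usual way, and with `ℂⁿ` by the coordinates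
`z¹, …, zⁿ` of the preferred holomorphic chart `chartAt _ x`. -/

/-- The model space `ℂⁿ`. -/
abbrev Cn (n : ℕ) : Type := EuclideanSpace ℂ (Fin n)

/-- The tangent space at `x` of a manifold modelled on `ℂⁿ`. -/
abbrev TanSp (n : ℕ) {X : Type*} [TopologicalSpace X] [ChartedSpace (Cn n) X] (x : X) : Type :=
  TangentSpace 𝓘(ℂ, Cn n) x

/-- Complex-valued `1`-forms at `x`: real-linear maps from the tangent space at `x` to `ℂ`. -/
abbrev OneForm (n : ℕ) {X : Type*} [TopologicalSpace X] [ChartedSpace (Cn n) X] (x : X) : Type :=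
  TanSp n x →ₗ[ℝ] ℂ

/-- Complex-valued `2`-forms at `x`: alternating real-bilinear maps from the tangent space at `x`
to `ℂ`. -/
abbrev TwoForm (n : ℕ) {X : Type*} [TopologicalSpace X] [ChartedSpace (Cn n) X] (x : X) : Type :=
  TanSp n x [⋀^Fin 2]→ₗ[ℝ] ℂ

section Forms

variable {n : ℕ} {X : Type*} [TopologicalSpace X] [ChartedSpace (Cn n) X] {x : X}

namespace OneForm

/-- A `(1,0)`-form at `x`: a complex-linear `1`-form. -/
def IsType10 (a : OneForm n x) : Prop := ∀ v : TanSp n x, a (Complex.I • v) = Complex.I * a v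

/-- A `(0,1)`-form at `x`: a conjugate-linear `1`-form. -/
def IsType01 (a : OneForm n x) : Prop := ∀ v : TanSp n x, a (Complex.I • v) = -(Complex.I * a v)

/-- The conjugate `1`-form. -/
def bar (a : OneForm n x) : OneForm n x := Complex.conjAe.toLinearMap ∘ₗ a

/-- The wedge product of two `1`-forms, `(a ∧ b)(v, w) = a(v) b(w) - a(w) b(v)`. -/
def wedge (a b : OneForm n x) : TwoForm n x where
  toFun v := a (v 0) * b (v 1) - a (v 1) * b (v 0)
  map_update_add' v i y z := by
    fin_cases i <;> simp <;> ring
  map_update_smul' v i c y := by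
    fin_cases i <;> simp <;> ring
  map_eq_zero_of_eq' v i j h hij := by
    fin_cases i <;> fin_cases j <;> simp_all

end OneForm

/-- The coordinate tangent vector at `x` in the direction `z^α` (the real vector `∂/∂x^α`, which
corresponds to `∂/∂z^α` in `T_x^{1,0} X`). -/
def coordVec (n : ℕ) {X : Type*} [TopologicalSpace X] [ChartedSpace (Cn n) X] (x : X)
    (α : Fin n) : TanSp n x :=
  (EuclideanSpace.single α (1 : ℂ) : Cn n)

/-- The `(1,0)`-form `dz^α` at `x`. -/
def dz (n : ℕ) {X : Type*} [TopologicalSpace X] [ChartedSpace (Cn n) X] (x : X)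
    (α : Fin n) : OneForm n x where
  toFun v := (show Cn n from v) α
  map_add' _ _ := rfl
  map_smul' _ _ := rfl

/-- The coefficient `a_α` of `a = ∑ a_α dz^α` for a `(1,0)`-form `a`, respectively `a_{ᾱ}` of
`a = ∑ a_{ᾱ} dz̄^α` for a `(0,1)`-form `a`. -/
def OneForm.coeff (a : OneForm n x) (α : Fin n) : ℂ := a (coordVec n x α)

/-- The product `A ∧ Cᵀ` of matrices of `1`-forms: its `(j, i)` entry is `∑_p A_{jp} ∧ C_{ip}`. -/
def wedgeTranspose {r N : ℕ} (A C : Matrix (Fin r) (Fin N) (OneForm n x)) :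
    Matrix (Fin r) (Fin r) (TwoForm n x) :=
  Matrix.of fun j i => ∑ p, (A j p).wedge (C i p)

/-- The matrix of coefficients of an `r × N` matrix `A` of `1`-forms: an `N × rn` matrix whose
entry in row `p` and column `(j, α)` is the coefficient `A_{jpα}`. -/
def coeffMatrix {r N : ℕ} (A : Matrix (Fin r) (Fin N) (OneForm n x)) :
    Matrix (Fin N) (Fin r × Fin n) ℂ :=
  Matrix.of fun p jα => (A jα.1 p).coeff jα.2

end Forms

/-! ### Wirtinger derivatives on `ℂⁿ` -/

/-- `∂f/∂z^α = (∂f/∂x^α - i ∂f/∂y^α) / 2`. -/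
def wirtinger {n : ℕ} (α : Fin n) (f : Cn n → ℂ) (z : Cn n) : ℂ :=
  (fderiv ℝ f z (EuclideanSpace.single α (1 : ℂ))
    - Complex.I * fderiv ℝ f z (EuclideanSpace.single α Complex.I)) / 2

/-- `∂f/∂z̄^α = (∂f/∂x^α + i ∂f/∂y^α) / 2`. -/
def wirtingerBar {n : ℕ} (α : Fin n) (f : Cn n → ℂ) (z : Cn n) : ℂ :=
  (fderiv ℝ f z (EuclideanSpace.single α (1 : ℂ))
    + Complex.I * fderiv ℝ f z (EuclideanSpace.single α Complex.I)) / 2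

/-! ### Hermitian holomorphic vector bundles and their Chern curvature -/

section Bundle

variable (n r : ℕ) {X : Type*} [TopologicalSpace X] [ChartedSpace (Cn n) X]
  (E : X → Type*) [TopologicalSpace (Bundle.TotalSpace (Cn r) E)]
  [∀ x, AddCommGroup (E x)] [∀ x, Module ℂ (E x)] [∀ x, TopologicalSpace (E x)]
  [FiberBundle (Cn r) E]

/-- A smooth Hermitian metric on a holomorphic vector bundle `E` of rank `r`: a positive definite
Hermitian form on each fibre, linear in the first and conjugate-linear in the second variable,
such that `h(s, t)` is a smooth function (in the real sense) for all local holomorphic sections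
`s` and `t`. -/
structure HermitianMetric where
  form : ∀ x : X, E x →ₗ[ℂ] E x →ₗ⋆[ℂ] ℂ
  conj_symm : ∀ (x : X) (v w : E x), conj (form x v w) = form x w v
  pos : ∀ (x : X) (v : E x), v ≠ 0 → 0 < form x v v
  smooth : ∀ (U : Set X), IsOpen U → ∀ s t : (Π x : X, E x),
    ContMDiffOn 𝓘(ℂ, Cn n) (𝓘(ℂ, Cn n).prod 𝓘(ℂ, Cn r)) ω
      (fun y => Bundle.TotalSpace.mk' (Cn r) y (s y)) U →
    ContMDiffOn 𝓘(ℂ, Cn n) (𝓘(ℂ, Cn n).prod 𝓘(ℂ, Cn r)) ω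
      (fun y => Bundle.TotalSpace.mk' (Cn r) y (t y)) U →
    ContMDiffOn 𝓘(ℝ, Cn n) 𝓘(ℝ, ℂ) ∞ (fun y => form y (s y) (t y)) U

/-- `e = (e_1, …, e_r)` is a holomorphic frame of `E` on some open neighbourhood of `x`. -/
def IsHolFrameNear (x : X) (e : Fin r → Π y : X, E y) : Prop :=
  ∃ U : Set X, IsOpen U ∧ x ∈ U ∧ IsLocalFrameOn 𝓘(ℂ, Cn n) (Cn r) ω e U

namespace HermitianMetric

variable {n r E} (h : HermitianMetric n r E)

/-- The matrix `h_{i k̄} = h(e_i, e_k)` of the metric in the frame `e`, as a function of the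
coordinates `z` of the preferred chart at `x`. -/
def gram (e : Fin r → Π y : X, E y) (x : X) (z : Cn n) : Matrix (Fin r) (Fin r) ℂ :=
  Matrix.of fun i k =>
    h.form ((chartAt (Cn n) x).symm z) (e i ((chartAt (Cn n) x).symm z))
      (e k ((chartAt (Cn n) x).symm z))

/-- The coefficients `θ^j_{iα}` of the Chern connection form `θ^j_i = ∑_k ∂h_{i k̄} h^{k̄ j}` with
respect to the holomorphic frame `e` (so `∇ e_i = ∑_j θ^j_i e_j`, `θ^j_i = ∑_α θ^j_{iα} dz^α`), in
the coordinates of the preferred chart at `x`. -/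
def connectionCoeff (e : Fin r → Π y : X, E y) (x : X) (j i : Fin r) (α : Fin n) (z : Cn n) : ℂ :=
  ∑ k, wirtinger α (fun w => h.gram e x w i k) z * (h.gram e x z)⁻¹ k j

/-- The coefficients `R^j_{iαβ̄}` at `x` of the Chern curvature
`R^j_i = ∂̄θ^j_i = ∑_{α,β} R^j_{iαβ̄} dz^α ∧ dz̄^β` in the holomorphic frame `e`;
the sign comes from `dz̄^β ∧ dz^α = - dz^α ∧ dz̄^β`. -/
def curvatureCoeff (e : Fin r → Π y : X, E y) (x : X) (j i : Fin r) (α β : Fin n) : ℂ :=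
  -wirtingerBar β (h.connectionCoeff e x j i α) (chartAt (Cn n) x x)

/-- The Chern curvature matrix `R = (R^j_i)` (`j` row, `i` column) at `x` with respect to the
holomorphic frame `e`, a matrix of `2`-forms at `x`. -/
def curvatureMatrix (e : Fin r → Π y : X, E y) (x : X) :
    Matrix (Fin r) (Fin r) (TwoForm n x) :=
  Matrix.of fun j i =>
    ∑ α, ∑ β, h.curvatureCoeff e x j i α β • (dz n x α).wedge (dz n x β).bar

/-- `R_{i j̄ α β̄} = ∑_k R^k_{iαβ̄} h_{k j̄}` at `x`. -/
def curvatureLower (e : Fin r → Π y : X, E y) (x : X) (i j : Fin r) (α β : Fin n) : ℂ :=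
  ∑ k, h.curvatureCoeff e x k i α β * h.form x (e k x) (e j x)

/-- Nakano positivity: `R_{i j̄ α β̄} u^{iα} conj(u^{jβ}) > 0` for all nonzero
`u = u^{iα} e_i ⊗ ∂_α` in `E ⊗ T^{1,0} X`, whatever the holomorphic frame. -/
def NakanoPositive : Prop :=
  ∀ (x : X) (e : Fin r → Π y : X, E y), IsHolFrameNear n r E x e →
    ∀ u : Fin r → Fin n → ℂ, u ≠ 0 →
      0 < ∑ i, ∑ j, ∑ α, ∑ β, h.curvatureLower e x i j α β * u i α * conj (u j β)

/-- Dual Nakano positivity: `R_{i j̄ α β̄} v^{j̄α} conj(v^{īβ}) > 0` for all nonzero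
`v = v^{j̄α} ē_j ⊗ ∂_α` in `Ē ⊗ T^{1,0} X`, whatever the holomorphic frame. -/
def DualNakanoPositive : Prop :=
  ∀ (x : X) (e : Fin r → Π y : X, E y), IsHolFrameNear n r E x e →
    ∀ v : Fin r → Fin n → ℂ, v ≠ 0 →
      0 < ∑ i, ∑ j, ∑ α, ∑ β, h.curvatureLower e x i j α β * v j α * conj (v i β)

/-- The frame `e` is unitary at `x`. -/
def IsUnitaryAt (e : Fin r → Π y : X, E y) (x : X) : Prop :=
  ∀ i j, h.form x (e i x) (e j x) = if i = j then 1 else 0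

end HermitianMetric

end Bundle

end

/-! The tensor `R_{i j̄ α β̄}` changes with the holomorphic frame by a congruence acting on the
bundle indices only, so both positivity conditions can be tested in one frame at each point, and a
frame unitary at that point exists. There dual Nakano positivity says that the matrix with rows
`(i, β)`, columns `(j, α)` and entries `R_{i j̄ α β̄} = R^j_{iαβ̄}` is positive definite. A
factorization of this matrix as `𝐀ᴴ 𝐀` amounts to `R = A ∧ Āᵀ` for the matrix `A` of `(1,0)`-forms
with coefficients `𝐀`, and `𝐀ᴴ 𝐀` is definite exactly when `𝐀` has full column rank. The Nakano
case is the dual one for the transposed tensor, since `-B ∧ B̄ᵀ` is the transpose of `A ∧ Āᵀ` for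
`A = B̄`. -/

noncomputable section

section WirtingerCalculus

open Complex

variable {V F 𝔄 : Type*} [NormedAddCommGroup V] [NormedSpace ℂ V]

/-- The Wirtinger derivatives of `f` along `v`: the derivative `∂ᵥf` of type `(1,0)` for `c = -i`,
and the derivative `∂̄ᵥf` of type `(0,1)` for `c = i`. -/
def wirtingerDeriv [NormedAddCommGroup F] [NormedSpace ℂ F] (c : ℂ) (v : V) (f : V → F) (z : V) :
    F :=
  (2⁻¹ : ℂ) • (fderiv ℝ f z v + c • fderiv ℝ f z (I • v))

local notation "∂" => wirtingerDeriv (-I)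

local notation "∂̄" => wirtingerDeriv I

section NormedSpace

variable [NormedAddCommGroup F] [NormedSpace ℂ F]

variable {c : ℂ} {v : V} {f g : V → F} {z : V}

lemma wirtingerDeriv_congr (h : f =ᶠ[nhds z] g) :
    wirtingerDeriv c v f z = wirtingerDeriv c v g z := by
  simp only [wirtingerDeriv, h.fderiv_eq]

lemma wirtingerDeriv_add (hf : DifferentiableAt ℝ f z) (hg : DifferentiableAt ℝ g z) :
    wirtingerDeriv c v (f + g) z = wirtingerDeriv c v f z + wirtingerDeriv c v g z := by
  simp only [wirtingerDeriv, fderiv_add hf hg, add_apply]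
  module

lemma wirtingerDeriv_clm_comp {F' : Type*} [NormedAddCommGroup F'] [NormedSpace ℂ F']
    (L : F →L[ℂ] F') (hf : DifferentiableAt ℝ f z) :
    wirtingerDeriv c v (fun w => L (f w)) z = L (wirtingerDeriv c v f z) := by
  have h : fderiv ℝ (fun w => L (f w)) z = (L.restrictScalars ℝ).comp (fderiv ℝ f z) :=
    ((L.restrictScalars ℝ).hasFDerivAt.comp z hf.hasFDerivAt).fderiv
  simp [wirtingerDeriv, h]

lemma holDeriv_star [StarAddMonoid F] [StarModule ℂ F] [ContinuousStar F] :
    ∂ v (star f) z = star (∂̄ v f z) := by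
  have h : fderiv ℝ (star f) z = (starL' ℝ : F ≃L[ℝ] F) ∘L fderiv ℝ f z := fderiv_star
  simp [wirtingerDeriv, h, star_smul]

lemma differentiableAt_wirtingerDeriv (hf : ContDiffAt ℝ 2 f z) :
    DifferentiableAt ℝ (wirtingerDeriv c v f) z := by
  have h : DifferentiableAt ℝ (fderiv ℝ f) z :=
    (hf.fderiv_right (m := 1) (by norm_num)).differentiableAt one_ne_zero
  unfold wirtingerDeriv
  fun_prop

lemma antiholDeriv_eq_zero (hf : DifferentiableAt ℂ f z) : ∂̄ v f z = 0 := by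
  simp [wirtingerDeriv, hf.fderiv_restrictScalars ℝ, smul_smul]

lemma holDeriv_eq_fderiv (hf : DifferentiableAt ℂ f z) : ∂ v f z = fderiv ℂ f z v := by
  simp only [wirtingerDeriv, hf.fderiv_restrictScalars ℝ,
    ContinuousLinearMap.coe_restrictScalars', map_smul, smul_smul, neg_mul, I_mul_I, neg_neg]
  module

end NormedSpace

section NormedAlgebra

variable [NormedRing 𝔄] [NormedAlgebra ℂ 𝔄] {c : ℂ} {v : V} {f g : V → 𝔄} {z : V}

lemma wirtingerDeriv_mul (hf : DifferentiableAt ℝ f z) (hg : DifferentiableAt ℝ g z) :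
    wirtingerDeriv c v (f * g) z = f z * wirtingerDeriv c v g z + wirtingerDeriv c v f z * g z := by
  simp only [wirtingerDeriv, fderiv_mul' hf hg, add_apply, smul_apply, smul_eq_mul,
    MulOpposite.smul_eq_mul_unop, MulOpposite.unop_op, smul_add, mul_add,
    add_mul, smul_mul_assoc, mul_smul_comm]
  abel

open scoped Ring

/-- The Chern connection form `θ = ∂H · H⁻¹` of the metric with Gram matrix `H`, evaluated on
`v`. -/
def chernConnection (v : V) (H : V → 𝔄) (z : V) : 𝔄 := ∂ v H z * (H z)⁻¹ʳ

/-- The coefficient of the Chern curvature `∂̄θ` of the metric with Gram matrix `H` in the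
directions `v` (of type `(1,0)`) and `w` (of type `(0,1)`). The sign comes from
`dw̄ ∧ dv = -dv ∧ dw̄`. -/
def chernCurvature (v w : V) (H : V → 𝔄) (z : V) : 𝔄 := -∂̄ w (chernConnection v H) z

variable {w : V} {G H H' : V → 𝔄}

lemma chernConnection_mul_self (hH : IsUnit (H z)) : chernConnection v H z * H z = ∂ v H z := by
  rw [chernConnection, Ring.inverse_mul_cancel_right _ _ hH]

lemma chernCurvature_congr (h : H =ᶠ[nhds z] H') :
    chernCurvature v w H z = chernCurvature v w H' z := by
  refine congrArg Neg.neg (wirtingerDeriv_congr ?_)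
  filter_upwards [h.eventuallyEq_nhds] with y hy
  simp only [chernConnection, wirtingerDeriv_congr hy, hy.self_of_nhds]

lemma differentiableAt_chernConnection [CompleteSpace 𝔄] (hH : ContDiffAt ℝ 2 H z)
    (hz : IsUnit (H z)) : DifferentiableAt ℝ (chernConnection v H) z :=
  (differentiableAt_wirtingerDeriv hH).mul ((hH.differentiableAt two_ne_zero).inverse hz)

variable [StarRing 𝔄] [StarModule ℂ 𝔄] [ContinuousStar 𝔄]

lemma holDeriv_conj (hG : DifferentiableAt ℂ G z) (hH : DifferentiableAt ℝ H z) :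
    ∂ v (G * H * star G) z = (∂ v G z * H z + G z * ∂ v H z) * star (G z) := by
  have hGℝ : DifferentiableAt ℝ G z := hG.restrictScalars ℝ
  have hstar : ∂ v (star G) z = 0 := by rw [holDeriv_star, antiholDeriv_eq_zero hG, star_zero]
  rw [wirtingerDeriv_mul (hGℝ.mul hH) (g := star G) hGℝ.star, wirtingerDeriv_mul hGℝ hH, hstar,
    mul_zero, zero_add, add_comm, Pi.star_apply]

lemma chernConnection_conj_mul (hG : DifferentiableAt ℂ G z) (hH : DifferentiableAt ℝ H z)
    (hGz : IsUnit (G z)) (hHz : IsUnit (H z)) :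
    chernConnection v (G * H * star G) z * G z = ∂ v G z + G z * chernConnection v H z := by
  have hunit : IsUnit ((G * H * star G) z) := (hGz.mul hHz).mul hGz.star
  apply (hHz.mul hGz.star).mul_right_cancel
  calc chernConnection v (G * H * star G) z * G z * (H z * star (G z))
      = ∂ v (G * H * star G) z := by
        rw [← chernConnection_mul_self hunit]; simp only [Pi.mul_apply, Pi.star_apply, mul_assoc]
    _ = (∂ v G z + G z * chernConnection v H z) * (H z * star (G z)) := by
        rw [holDeriv_conj hG hH, ← chernConnection_mul_self hHz]; noncomm_ring

lemma chernCurvature_conj_mul [CompleteSpace 𝔄] (hG : AnalyticAt ℂ G z) (hH : ContDiffAt ℝ 2 H z)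
    (hGz : IsUnit (G z)) (hHz : IsUnit (H z)) :
    chernCurvature v w (G * H * star G) z * G z = G z * chernCurvature v w H z := by
  have hGℂ := hG.differentiableAt
  have hGℝ : DifferentiableAt ℝ G z := hGℂ.restrictScalars ℝ
  have hdelG : DifferentiableAt ℂ (∂ v G) z := by
    refine DifferentiableAt.congr_of_eventuallyEq ?_
      (hG.eventually_analyticAt.mono fun y hy => holDeriv_eq_fderiv hy.differentiableAt)
    exact hG.fderiv.differentiableAt.clm_apply (differentiableAt_const v)
  have hGC : ContDiffAt ℝ 2 G z := hG.contDiffAt.restrict_scalars ℝ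
  have hGstar : ContDiffAt ℝ 2 (star G) z :=
    (starL' ℝ : 𝔄 ≃L[ℝ] 𝔄).contDiff.contDiffAt.comp z hGC
  have hθ' := differentiableAt_chernConnection (v := v) (H := G * H * star G)
    ((hGC.mul hH).mul hGstar) ((hGz.mul hHz).mul hGz.star)
  have hθ := differentiableAt_chernConnection (v := v) hH hHz
  have hconn : chernConnection v (G * H * star G) * G
      =ᶠ[nhds z] ∂ v G + G * chernConnection v H := by
    filter_upwards [hG.eventually_analyticAt, hH.eventually (by simp),
      hG.continuousAt.eventually (Units.isOpen.mem_nhds hGz),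
      hH.continuousAt.eventually (Units.isOpen.mem_nhds hHz)]
      with y hGy hHy hGu hHu
    exact chernConnection_conj_mul hGy.differentiableAt (hHy.differentiableAt two_ne_zero) hGu hHu
  have hbar := wirtingerDeriv_congr (c := I) (v := w) hconn
  rw [wirtingerDeriv_mul hθ' hGℝ, wirtingerDeriv_add (hdelG.restrictScalars ℝ) (hGℝ.mul hθ),
    wirtingerDeriv_mul hGℝ hθ, antiholDeriv_eq_zero hGℂ, antiholDeriv_eq_zero hdelG] at hbar
  simpa [chernCurvature] using hbar

end NormedAlgebra

end WirtingerCalculus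

section MatrixCalculus

open Complex
open scoped Matrix.Norms.Frobenius

variable {ι κ : Type*} [Fintype ι] [Fintype κ]

lemma contDiffAt_matrix {𝕜 V : Type*} [NontriviallyNormedField 𝕜] [NormedAlgebra 𝕜 ℂ]
    [NormedAddCommGroup V] [NormedSpace 𝕜 V] {k : ℕ∞ω} {H : V → Matrix ι κ ℂ} {z : V}
    (hH : ∀ i j, ContDiffAt 𝕜 k (fun w => H w i j) z) : ContDiffAt 𝕜 k H z := by
  classical
  have hsum : H = fun w => ∑ i, ∑ j, H w i j • Matrix.single i j (1 : ℂ) := by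
    ext1 w
    simpa [Matrix.smul_single] using Matrix.matrix_eq_sum_single (H w)
  rw [hsum]
  exact ContDiffAt.sum fun i _ => ContDiffAt.sum fun j _ => (hH i j).smul contDiffAt_const

lemma wirtingerDeriv_matrix_apply {V : Type*} [NormedAddCommGroup V] [NormedSpace ℂ V] {c : ℂ}
    {v : V} {H : V → Matrix ι κ ℂ} {z : V} (hH : DifferentiableAt ℝ H z) (i : ι) (j : κ) :
    wirtingerDeriv c v (fun w => H w i j) z = wirtingerDeriv c v H z i j :=
  wirtingerDeriv_clm_comp (Matrix.entryLinearMap ℂ ℂ i j).toContinuousLinearMap hH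

variable {n : ℕ} {z : Cn n} {α : Fin n}

lemma I_smul_single :
    I • (EuclideanSpace.single α 1 : Cn n) = EuclideanSpace.single α I := by
  ext i; simp

lemma wirtinger_eq (f : Cn n → ℂ) :
    wirtinger α f z = wirtingerDeriv (-I) (EuclideanSpace.single α 1) f z := by
  rw [wirtinger, wirtingerDeriv, I_smul_single, smul_eq_mul, smul_eq_mul]
  ring

lemma wirtingerBar_eq (f : Cn n → ℂ) :
    wirtingerBar α f z = wirtingerDeriv I (EuclideanSpace.single α 1) f z := by
  rw [wirtingerBar, wirtingerDeriv, I_smul_single, smul_eq_mul, smul_eq_mul]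
  ring

end MatrixCalculus

section BlockMatrices

open Matrix
open scoped Kronecker

variable {ι κ : Type*}

/-- The block matrix of the Hermitian form `∑ L_{i j̄ α β̄} v^{j̄α} conj(v^{īβ})` defining dual
Nakano positivity, where `L α β` is the matrix `(L_{i j̄ α β̄})_{ij}`. -/
def dualNakanoMatrix (L : κ → κ → Matrix ι ι ℂ) : Matrix (ι × κ) (ι × κ) ℂ :=
  of fun iβ jα => L jα.2 iβ.2 iβ.1 jα.1

/-- The block matrix of the Hermitian form `∑ L_{i j̄ α β̄} u^{iα} conj(u^{jβ})` defining Nakano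
positivity: that of the dual form for the transposed matrices. -/
def nakanoMatrix (L : κ → κ → Matrix ι ι ℂ) : Matrix (ι × κ) (ι × κ) ℂ :=
  dualNakanoMatrix fun α β => (L α β)ᵀ

variable [Fintype ι]

/-- Families of matrices indexed by pairs of coordinate directions that are congruent by one
invertible matrix, acting in the bundle directions only: the curvature tensors of a metric in two
frames are so related. -/
def FrameCongruent [DecidableEq ι] (L L' : κ → κ → Matrix ι ι ℂ) : Prop :=
  ∃ G : Matrix ι ι ℂ, IsUnit G ∧ ∀ α β, L α β = G * L' α β * star G

lemma FrameCongruent.transpose [DecidableEq ι] {L L' : κ → κ → Matrix ι ι ℂ}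
    (hL : FrameCongruent L L') :
    FrameCongruent (fun α β => (L α β)ᵀ) fun α β => (L' α β)ᵀ := by
  obtain ⟨G, hG, hLG⟩ := hL
  refine ⟨(star G)ᵀ, (isUnit_transpose _).mpr hG.star, fun α β => ?_⟩
  have hstar : star (star G)ᵀ = Gᵀ := by
    ext i j
    simp [star_apply]
  simp only [hLG, transpose_mul, mul_assoc, hstar]

lemma posDef_of_forall_pos {M : Matrix ι ι ℂ}
    (hM : ∀ x : ι → ℂ, x ≠ 0 → 0 < star x ⬝ᵥ (M *ᵥ x)) : M.PosDef := by
  classical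
  refine .of_dotProduct_mulVec_pos ?_ fun x hx => hM x hx
  -- Over `ℂ` a matrix with real quadratic form is Hermitian.
  rw [← isSymmetric_toEuclideanLin_iff, LinearMap.isSymmetric_iff_inner_map_self_real]
  intro v
  have hnonneg : 0 ≤ star v.ofLp ⬝ᵥ (M *ᵥ v.ofLp) := by
    by_cases hv : v.ofLp = 0
    · simp [hv]
    · exact (hM _ hv).le
  have hinner : inner ℂ (M.toEuclideanLin v) v = conj (star v.ofLp ⬝ᵥ (M *ᵥ v.ofLp)) := by
    rw [← inner_conj_symm, EuclideanSpace.inner_eq_star_dotProduct, dotProduct_comm]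
    rfl
  rw [hinner, Complex.conj_conj, Complex.conj_eq_iff_im.mpr (Complex.nonneg_iff.mp hnonneg).2.symm]

lemma posDef_conjTranspose_mul_self_iff_rank [Fintype κ] (C : Matrix κ ι ℂ) :
    (Cᴴ * C).PosDef ↔ C.rank = Fintype.card ι := by
  classical
  rw [(posSemidef_conjTranspose_mul_self C).posDef_iff_isUnit, ← rank_conjTranspose_mul_self]
  refine ⟨fun h => rank_of_isUnit _ h, fun h => ?_⟩
  rw [← linearIndependent_cols_iff_isUnit, linearIndependent_iff_card_eq_finrank_span, ← h,
    rank_eq_finrank_span_cols]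
  rfl

lemma exists_eq_conjTranspose_mul_self {M : Matrix ι ι ℂ} (hM : M.PosSemidef) :
    ∃ C : Matrix (Fin (Fintype.card ι)) ι ℂ, M = Cᴴ * C := by
  classical
  open scoped MatrixOrder in
  obtain ⟨S, hS⟩ := CStarAlgebra.nonneg_iff_eq_star_mul_self.mp hM.nonneg
  refine ⟨S.submatrix (Fintype.equivFin ι).symm id, ?_⟩
  rw [hS, conjTranspose_submatrix, submatrix_mul_equiv]
  rfl

lemma posDef_prod_iff [Fintype κ] {M : Matrix (ι × κ) (ι × κ) ℂ} :
    M.PosDef ↔ ∀ v : ι → κ → ℂ, v ≠ 0 →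
      0 < ∑ i, ∑ j, ∑ α, ∑ β, M (i, β) (j, α) * v j α * conj (v i β) := by
  have hform (v : ι → κ → ℂ) : star (Function.uncurry v) ⬝ᵥ (M *ᵥ Function.uncurry v) =
      ∑ i, ∑ j, ∑ α, ∑ β, M (i, β) (j, α) * v j α * conj (v i β) := by
    simp only [dotProduct, mulVec, Fintype.sum_prod_type, Finset.mul_sum]
    exact Finset.sum_congr rfl fun i _ => Finset.sum_comm.trans <|
      Finset.sum_congr rfl fun j _ => Finset.sum_comm.trans <|
      Finset.sum_congr rfl fun α _ => Finset.sum_congr rfl fun β _ => mul_comm _ _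
  simp only [← hform]
  constructor
  · exact fun hM v hv => hM.dotProduct_mulVec_pos fun h => hv (Function.uncurry_injective h)
  · refine fun hM => posDef_of_forall_pos fun x hx => ?_
    simpa only [Function.uncurry_curry] using hM (Function.curry x) fun h =>
      hx (Function.curry_injective h)

namespace FrameCongruent

variable [DecidableEq ι] [Finite κ] {L L' : κ → κ → Matrix ι ι ℂ}

lemma posDef_dualNakanoMatrix_iff (hL : FrameCongruent L L') :
    (dualNakanoMatrix L).PosDef ↔ (dualNakanoMatrix L').PosDef := by
  classical
  have := Fintype.ofFinite κ
  obtain ⟨G, hG, hLG⟩ := hL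
  have hcongr : dualNakanoMatrix L = (G ⊗ₖ (1 : Matrix κ κ ℂ)) * dualNakanoMatrix L' *
      star (G ⊗ₖ (1 : Matrix κ κ ℂ)) := by
    ext ⟨i, β⟩ ⟨j, α⟩
    simp [dualNakanoMatrix, hLG, star_eq_conjTranspose, conjTranspose_kronecker, mul_apply,
      Fintype.sum_prod_type, one_apply, Finset.sum_mul]
  rw [hcongr]
  exact (hG.kronecker isUnit_one).posDef_star_right_conjugate_iff

lemma posDef_nakanoMatrix_iff (hL : FrameCongruent L L') :
    (nakanoMatrix L).PosDef ↔ (nakanoMatrix L').PosDef :=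
  hL.transpose.posDef_dualNakanoMatrix_iff

end FrameCongruent

end BlockMatrices

section Frames

open scoped Matrix.Norms.Frobenius

variable {n r : ℕ} {X : Type*} [TopologicalSpace X] [ChartedSpace (Cn n) X]
  {E : X → Type*} [TopologicalSpace (Bundle.TotalSpace (Cn r) E)]
  [∀ x, AddCommGroup (E x)] [∀ x, Module ℂ (E x)] [∀ x, TopologicalSpace (E x)]
  [FiberBundle (Cn r) E] {e f : Fin r → Π y : X, E y} {x : X} {α β : Fin n}

lemma contDiffAt_comp_chartAt_symm {𝕜 : Type*} [NontriviallyNormedField 𝕜] [NormedSpace 𝕜 (Cn n)]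
    [NormedSpace 𝕜 ℂ] {k : ℕ∞ω} {f : X → ℂ} (hf : ContMDiffAt 𝓘(𝕜, Cn n) 𝓘(𝕜, ℂ) k f x) :
    ContDiffAt 𝕜 k (fun z => f ((chartAt (Cn n) x).symm z)) (chartAt (Cn n) x x) := by
  have h := (contMDiffAt_iff.mp hf).2
  rwa [modelWithCornersSelf_coe, Set.range_id, contDiffWithinAt_univ] at h

namespace HermitianMetric

variable (h : HermitianMetric n r E)

lemma gram_chartAt (e : Fin r → Π y : X, E y) (x : X) (i k : Fin r) :
    h.gram e x (chartAt (Cn n) x x) i k = h.form x (e i x) (e k x) := by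
  rw [gram, Matrix.of_apply, (chartAt (Cn n) x).left_inv (mem_chart_source _ x)]

lemma contDiffAt_gram (he : IsHolFrameNear n r E x e) :
    ContDiffAt ℝ 2 (h.gram e x) (chartAt (Cn n) x x) := by
  obtain ⟨U, hU, hxU, hframe⟩ := he
  refine contDiffAt_matrix fun i k => ?_
  have hik := (h.smooth U hU _ _ (hframe.contMDiffOn i) (hframe.contMDiffOn k)).contMDiffAt
    (hU.mem_nhds hxU)
  exact contDiffAt_infty.mp (contDiffAt_comp_chartAt_symm hik) 2

/-- The matrix `(R_{i j̄ α β̄})_{ij}`. -/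
def lowerMatrix (e : Fin r → Π y : X, E y) (x : X) (α β : Fin n) : Matrix (Fin r) (Fin r) ℂ :=
  Matrix.of fun i j => h.curvatureLower e x i j α β

variable {h}

lemma connectionCoeff_eq {z : Cn n} (hH : DifferentiableAt ℝ (h.gram e x) z) (j i : Fin r) :
    h.connectionCoeff e x j i α z =
      chernConnection (EuclideanSpace.single α 1) (h.gram e x) z i j := by
  simp only [connectionCoeff, chernConnection, Matrix.mul_apply, wirtinger_eq,
    wirtingerDeriv_matrix_apply hH, Matrix.nonsing_inv_eq_ringInverse]

lemma curvatureCoeff_eq (he : IsHolFrameNear n r E x e)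
    (hunit : IsUnit (h.gram e x (chartAt (Cn n) x x))) (j i : Fin r) :
    h.curvatureCoeff e x j i α β =
      chernCurvature (EuclideanSpace.single α 1) (EuclideanSpace.single β 1) (h.gram e x)
        (chartAt (Cn n) x x) i j := by
  have hH := h.contDiffAt_gram he
  have hconn : h.connectionCoeff e x j i α =ᶠ[nhds (chartAt (Cn n) x x)]
      fun z => chernConnection (EuclideanSpace.single α 1) (h.gram e x) z i j :=
    (hH.eventually (by simp)).mono fun z hz =>
      connectionCoeff_eq (hz.differentiableAt two_ne_zero) j i
  rw [curvatureCoeff, wirtingerBar_eq, wirtingerDeriv_congr hconn,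
    wirtingerDeriv_matrix_apply (differentiableAt_chernConnection hH hunit)]
  rfl

lemma lowerMatrix_eq (he : IsHolFrameNear n r E x e)
    (hunit : IsUnit (h.gram e x (chartAt (Cn n) x x))) :
    h.lowerMatrix e x α β =
      chernCurvature (EuclideanSpace.single α 1) (EuclideanSpace.single β 1) (h.gram e x)
        (chartAt (Cn n) x x) * h.gram e x (chartAt (Cn n) x x) := by
  ext i j
  simp only [lowerMatrix, Matrix.of_apply, curvatureLower, curvatureCoeff_eq he hunit,
    Matrix.mul_apply, gram_chartAt]

lemma gram_eq_of_eq_sum {z : Cn n} {G : Matrix (Fin r) (Fin r) ℂ}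
    (hG : ∀ i, e i ((chartAt (Cn n) x).symm z) = ∑ j, G i j • f j ((chartAt (Cn n) x).symm z)) :
    h.gram e x z = G * h.gram f x z * star G := by
  ext i k
  simp only [gram, Matrix.of_apply, hG, Matrix.mul_apply, Matrix.star_apply, map_sum,
    LinearMap.sum_apply, map_smul, LinearMap.smul_apply, LinearMap.map_smulₛₗ, smul_eq_mul,
    Finset.sum_mul, Finset.mul_sum]
  refine Finset.sum_congr rfl fun a _ => Finset.sum_congr rfl fun b _ => ?_
  rw [RCLike.star_def]
  ring

lemma lowerMatrix_change_frame (he : IsHolFrameNear n r E x e) (hf : IsHolFrameNear n r E x f)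
    (hunit : IsUnit (h.gram f x (chartAt (Cn n) x x)))
    {G : Cn n → Matrix (Fin r) (Fin r) ℂ} (hG : AnalyticAt ℂ G (chartAt (Cn n) x x))
    (hGunit : IsUnit (G (chartAt (Cn n) x x)))
    (hGef : ∀ᶠ z in nhds (chartAt (Cn n) x x), ∀ i, e i ((chartAt (Cn n) x).symm z)
      = ∑ j, G z i j • f j ((chartAt (Cn n) x).symm z)) :
    h.lowerMatrix e x α β = G (chartAt (Cn n) x x) * h.lowerMatrix f x α β
      * star (G (chartAt (Cn n) x x)) := by
  have hgram : h.gram e x =ᶠ[nhds (chartAt (Cn n) x x)] G * h.gram f x * star G :=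
    hGef.mono fun z hz => gram_eq_of_eq_sum hz
  have hgram_x := hgram.self_of_nhds
  simp only [Pi.mul_apply, Pi.star_apply] at hgram_x
  have hunit' : IsUnit (h.gram e x (chartAt (Cn n) x x)) := by
    rw [hgram_x]
    exact (hGunit.mul hunit).mul hGunit.star
  rw [lowerMatrix_eq he hunit', lowerMatrix_eq hf hunit, chernCurvature_congr hgram, hgram_x,
    ← mul_assoc, ← mul_assoc, chernCurvature_conj_mul hG (h.contDiffAt_gram hf) hGunit hunit,
    mul_assoc (G _)]

lemma IsUnitaryAt.gram_eq_one (hu : h.IsUnitaryAt e x) :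
    h.gram e x (chartAt (Cn n) x x) = 1 := by
  ext i k
  rw [gram_chartAt, hu, Matrix.one_apply]

end HermitianMetric

lemma IsHolFrameNear.linearIndependent (he : IsHolFrameNear n r E x e) :
    LinearIndependent ℂ fun i => e i x := by
  obtain ⟨U, -, hxU, hframe⟩ := he
  exact hframe.linearIndependent hxU

lemma isUnit_of_linearIndependent_sum {ι K M : Type*} [Fintype ι] [DecidableEq ι] [Field K]
    [AddCommGroup M] [Module K M] {v w : ι → M} {G : Matrix ι ι K} (hv : LinearIndependent K v)
    (hG : ∀ i, v i = ∑ j, G i j • w j) : IsUnit G := by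
  have hcomp : Fintype.linearCombination K v =
      Fintype.linearCombination K w ∘ₗ Matrix.vecMulLinear G := by
    ext i
    simp [hG, Fintype.linearCombination_apply]
  rw [linearIndependent_iff_injective_fintypeLinearCombination, hcomp, LinearMap.coe_comp] at hv
  exact Matrix.vecMul_injective_iff_isUnit.mp hv.of_comp

lemma exists_orthonormal_basis_of_form {r : ℕ} {V : Type*} [AddCommGroup V] [Module ℂ V]
    [FiniteDimensional ℂ V] (hr : Module.finrank ℂ V = r) (φ : V →ₗ[ℂ] V →ₗ⋆[ℂ] ℂ)
    (hsymm : ∀ v w, conj (φ v w) = φ w v) (hpos : ∀ v, v ≠ 0 → 0 < φ v v) :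
    ∃ b : Module.Basis (Fin r) ℂ V, ∀ i j, φ (b i) (b j) = if i = j then 1 else 0 := by
  let core : InnerProductSpace.Core ℂ V :=
    { inner := fun v w => φ w v
      conj_inner_symm := fun v w => hsymm _ _
      re_inner_nonneg := fun v => by
        by_cases hv : v = 0
        · simp [hv]
        · exact (Complex.pos_iff.mp (hpos v hv)).1.le
      add_left := by simp
      smul_left := by simp
      definite := fun v hv => by
        by_contra hne
        exact (hpos v hne).ne' hv }
  let : NormedAddCommGroup V := core.toNormedAddCommGroup
  let : InnerProductSpace ℂ V := InnerProductSpace.ofCore core.toCore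
  let b := (stdOrthonormalBasis ℂ V).reindex (finCongr hr)
  refine ⟨b.toBasis, fun i j => ?_⟩
  simp only [OrthonormalBasis.coe_toBasis, eq_comm (a := i)]
  exact orthonormal_iff_ite.mp b.orthonormal j i

variable [VectorBundle ℂ (Cn r) E]

lemma HermitianMetric.exists_isUnitaryAt_localFrame (h : HermitianMetric n r E) (x : X) :
    ∃ b : Module.Basis (Fin r) ℂ (Cn r),
      h.IsUnitaryAt ((trivializationAt (Cn r) E x).localFrame b) x := by
  let t := trivializationAt (Cn r) E x
  have hx : x ∈ t.baseSet := FiberBundle.mem_baseSet_trivializationAt' x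
  let Φ := t.linearEquivAt ℂ x hx
  have : FiniteDimensional ℂ (E x) := Module.Finite.equiv Φ.symm
  obtain ⟨b, hb⟩ := exists_orthonormal_basis_of_form (r := r) (by rw [Φ.finrank_eq]; simp)
    (h.form x) (h.conj_symm x) (h.pos x)
  have hframe (i : Fin r) : t.localFrame (b.map Φ) i x = b i := by
    rw [t.localFrame_apply_of_mem_baseSet (b.map Φ) hx]
    exact Φ.symm_apply_apply (b i)
  exact ⟨b.map Φ, fun i j => by rw [hframe, hframe, hb]⟩

variable [ContMDiffVectorBundle ω (Cn r) E 𝓘(ℂ, Cn n)]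

lemma IsHolFrameNear.exists_eq_sum_localFrame [IsManifold 𝓘(ℂ, Cn n) ω X]
    (he : IsHolFrameNear n r E x e) (b : Module.Basis (Fin r) ℂ (Cn r)) :
    ∃ G : Cn n → Matrix (Fin r) (Fin r) ℂ, AnalyticAt ℂ G (chartAt (Cn n) x x) ∧
      ∀ᶠ z in nhds (chartAt (Cn n) x x), ∀ i, e i ((chartAt (Cn n) x).symm z)
        = ∑ j, G z i j • (trivializationAt (Cn r) E x).localFrame b j
          ((chartAt (Cn n) x).symm z) := by
  have : ContMDiffVectorBundle 1 (Cn r) E 𝓘(ℂ, Cn n) :=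
    ContMDiffVectorBundle.of_le (n := ω) le_top
  set t := trivializationAt (Cn r) E x
  have hx : x ∈ t.baseSet := FiberBundle.mem_baseSet_trivializationAt' x
  obtain ⟨U, hU, hxU, hframe⟩ := he
  refine ⟨fun z => Matrix.of fun i j => t.localFrameCoeff 𝓘(ℂ, Cn n) b j
    ((chartAt (Cn n) x).symm z) (e i ((chartAt (Cn n) x).symm z)), ?_, ?_⟩
  · exact (contDiffAt_matrix fun i j => contDiffAt_comp_chartAt_symm
      (contMDiffAt_localFrameCoeff b hx (hframe.contMDiffAt hU hxU i) j)).analyticAt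
  · have hnear : ∀ᶠ z in nhds (chartAt (Cn n) x x), (chartAt (Cn n) x).symm z ∈ t.baseSet := by
      refine ((chartAt (Cn n) x).continuousAt_symm (mem_chart_target _ x)).eventually_mem ?_
      rw [(chartAt (Cn n) x).left_inv (mem_chart_source _ x)]
      exact t.open_baseSet.mem_nhds hx
    filter_upwards [hnear] with z hz i
    exact t.eq_sum_localFrameCoeff_smul (I := 𝓘(ℂ, Cn n)) (s := e i) hz

lemma isHolFrameNear_localFrame (x : X) (b : Module.Basis (Fin r) ℂ (Cn r)) :
    IsHolFrameNear n r E x ((trivializationAt (Cn r) E x).localFrame b) :=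
  ⟨_, Bundle.Trivialization.open_baseSet _, FiberBundle.mem_baseSet_trivializationAt' x,
    Bundle.Trivialization.isLocalFrameOn_localFrame_baseSet 𝓘(ℂ, Cn n) ω _ b⟩

namespace HermitianMetric

variable [IsManifold 𝓘(ℂ, Cn n) ω X] {h : HermitianMetric n r E}

lemma IsUnitaryAt.frameCongruent {b : Module.Basis (Fin r) ℂ (Cn r)}
    (hu : h.IsUnitaryAt ((trivializationAt (Cn r) E x).localFrame b) x)
    (he : IsHolFrameNear n r E x e) :
    FrameCongruent (h.lowerMatrix e x)
      (h.lowerMatrix ((trivializationAt (Cn r) E x).localFrame b) x) := by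
  obtain ⟨G, hG, hGe⟩ := he.exists_eq_sum_localFrame b
  have hGx := hGe.self_of_nhds
  rw [(chartAt (Cn n) x).left_inv (mem_chart_source _ x)] at hGx
  have hGunit := isUnit_of_linearIndependent_sum he.linearIndependent hGx
  exact ⟨_, hGunit, fun α β => lowerMatrix_change_frame he (isHolFrameNear_localFrame x b)
    (hu.gram_eq_one ▸ isUnit_one) hG hGunit hGe⟩

lemma forall_frame_iff_exists_unitary {P : (Fin n → Fin n → Matrix (Fin r) (Fin r) ℂ) → Prop}
    (hP : ∀ {L L'}, FrameCongruent L L' → (P L ↔ P L')) :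
    (∀ (x : X) (e : Fin r → Π y : X, E y), IsHolFrameNear n r E x e → P (h.lowerMatrix e x)) ↔
      ∀ x : X, ∃ e : Fin r → Π y : X, E y, IsHolFrameNear n r E x e ∧ h.IsUnitaryAt e x ∧
        P (h.lowerMatrix e x) := by
  refine forall_congr' fun x => ?_
  obtain ⟨b, hb⟩ := h.exists_isUnitaryAt_localFrame x
  constructor
  · exact fun hall => ⟨_, isHolFrameNear_localFrame x b, hb, hall _ (isHolFrameNear_localFrame x b)⟩
  · rintro ⟨e₀, he₀, -, hPe₀⟩ e he
    exact (hP (hb.frameCongruent he)).mpr ((hP (hb.frameCongruent he₀)).mp hPe₀)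

end HermitianMetric

end Frames

section Forms

open Matrix

variable {n r N : ℕ} {X : Type*} [TopologicalSpace X] [ChartedSpace (Cn n) X] {x : X}

lemma dz_coordVec (γ α : Fin n) : dz n x γ (coordVec n x α) = if γ = α then 1 else 0 := by
  change (EuclideanSpace.single α (1 : ℂ) : Cn n) γ = _
  simp

lemma dz_I_smul (γ : Fin n) (v : TanSp n x) :
    dz n x γ (Complex.I • v) = Complex.I * dz n x γ v := rfl

lemma TwoForm.sum_apply {ι : Type*} (s : Finset ι) (η : ι → TwoForm n x) (v : Fin 2 → TanSp n x) :
    (∑ p ∈ s, η p) v = ∑ p ∈ s, η p v :=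
  map_sum ({ toFun := fun η => η v, map_zero' := rfl, map_add' := fun _ _ => rfl } :
    TwoForm n x →+ ℂ) η s

namespace OneForm

variable {a b : OneForm n x}

lemma bar_apply (a : OneForm n x) (v : TanSp n x) : a.bar v = conj (a v) := rfl

lemma bar_involutive : Function.Involutive (bar (n := n) (x := x)) := fun a =>
  LinearMap.ext fun v => Complex.conj_conj (a v)

lemma isType10_bar_iff : a.bar.IsType10 ↔ a.IsType01 := by
  refine forall_congr' fun v => ?_
  rw [bar_apply, bar_apply, ← (starRingEnd ℂ).injective.eq_iff]
  simp

lemma wedge_apply (a b : OneForm n x) (v : Fin 2 → TanSp n x) :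
    a.wedge b v = a (v 0) * b (v 1) - a (v 1) * b (v 0) := rfl

lemma neg_wedge (a b : OneForm n x) : -a.wedge b = b.wedge a := by
  ext v
  simp only [AlternatingMap.neg_apply, wedge_apply]
  ring

end OneForm

/-- The `2`-form `∑ c_{αβ} dz^α ∧ dz̄^β` of type `(1,1)`. -/
def form11 (x : X) (c : Fin n → Fin n → ℂ) : TwoForm n x :=
  ∑ α, ∑ β, c α β • (dz n x α).wedge (dz n x β).bar

lemma form11_apply (c : Fin n → Fin n → ℂ) (v : Fin 2 → TanSp n x) :
    form11 x c v = ∑ α, ∑ β, c α β *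
      (dz n x α (v 0) * conj (dz n x β (v 1)) - dz n x α (v 1) * conj (dz n x β (v 0))) := by
  simp only [form11, TwoForm.sum_apply, AlternatingMap.smul_apply, smul_eq_mul,
    OneForm.wedge_apply, OneForm.bar_apply]

lemma form11_coeff (c : Fin n → Fin n → ℂ) (α β : Fin n) :
    (form11 x c ![coordVec n x α, coordVec n x β]
      + Complex.I * form11 x c ![coordVec n x α, Complex.I • coordVec n x β]) / 2 = c α β := by
  simp only [form11_apply, cons_val_zero, cons_val_one, dz_I_smul, dz_coordVec, map_mul,
    Complex.conj_I, apply_ite conj, map_one, map_zero, mul_sub, Finset.sum_sub_distrib]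
  simp only [mul_ite, mul_one, mul_zero, ite_mul, zero_mul, one_mul, mul_neg,
    Finset.sum_ite_eq', Finset.mem_univ, if_true, Finset.sum_neg_distrib]
  linear_combination (-(c α β) / 2 - c β α / 2) * Complex.I_mul_I

lemma form11_injective : Function.Injective (form11 (n := n) x) := by
  intro c d hcd
  ext α β
  rw [← form11_coeff (x := x) c, hcd, form11_coeff]

lemma form11_sum {ι : Type*} (s : Finset ι) (c : ι → Fin n → Fin n → ℂ) :
    ∑ p ∈ s, form11 x (c p) = form11 x fun α β => ∑ p ∈ s, c p α β := by
  ext v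
  simp only [TwoForm.sum_apply, form11_apply, Finset.sum_mul]
  exact Finset.sum_comm.trans (Finset.sum_congr rfl fun α _ => Finset.sum_comm)

namespace OneForm

variable {a b : OneForm n x}

lemma IsType10.apply_smul (ha : a.IsType10) (c : ℂ) (v : TanSp n x) : a (c • v) = c * a v := by
  have hc : c • v = c.re • v + c.im • (Complex.I • v) := by
    conv_lhs => rw [← Complex.re_add_im c, add_smul, mul_smul]
    rfl
  rw [hc, map_add, map_smul, map_smul, ha, Complex.real_smul, Complex.real_smul, ← mul_assoc,
    ← add_mul, Complex.re_add_im]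

lemma IsType10.apply_eq_sum (ha : a.IsType10) (v : TanSp n x) :
    a v = ∑ α, a.coeff α * dz n x α v := by
  have hv : v = ∑ α, dz n x α v • coordVec n x α := by
    have h := (EuclideanSpace.basisFun (Fin n) ℂ).sum_repr (show Cn n from v)
    simp only [EuclideanSpace.basisFun_apply] at h
    exact h.symm
  conv_lhs => rw [hv, map_sum]
  exact Finset.sum_congr rfl fun α _ => (ha.apply_smul _ _).trans (mul_comm _ _)

lemma IsType10.wedge_bar (ha : a.IsType10) (hb : b.IsType10) :
    a.wedge b.bar = form11 x fun α β => a.coeff α * conj (b.coeff β) := by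
  ext v
  simp only [wedge_apply, bar_apply, form11_apply, ha.apply_eq_sum (v _), hb.apply_eq_sum (v _),
    map_sum, map_mul, Finset.sum_mul_sum, ← Finset.sum_sub_distrib]
  refine Finset.sum_congr rfl fun α _ => Finset.sum_congr rfl fun β _ => ?_
  ring

lemma exists_isType10_coeff_eq (x : X) (c : Fin n → ℂ) :
    ∃ a : OneForm n x, a.IsType10 ∧ a.coeff = c := by
  refine ⟨∑ α, c α • dz n x α, fun v => ?_, ?_⟩
  · simp only [LinearMap.sum_apply, LinearMap.smul_apply, dz_I_smul, smul_eq_mul, Finset.mul_sum,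
      mul_left_comm]
  · ext α
    simp [coeff, dz_coordVec]

end OneForm

/-- The matrix of `2`-forms whose entry in row `j` and column `i` is
`∑ L_{i j̄ α β̄} dz^α ∧ dz̄^β`, where `L α β` is the matrix `(L_{i j̄ α β̄})_{ij}`. As for the
curvature matrix in a unitary frame, rows and columns are interchanged. -/
def formMatrix (x : X) (L : Fin n → Fin n → Matrix (Fin r) (Fin r) ℂ) :
    Matrix (Fin r) (Fin r) (TwoForm n x) :=
  of fun j i => form11 x fun α β => L α β i j

variable {L : Fin n → Fin n → Matrix (Fin r) (Fin r) ℂ}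

lemma formMatrix_eq_wedgeTranspose_iff {A : Matrix (Fin r) (Fin N) (OneForm n x)}
    (hA : ∀ j p, (A j p).IsType10) :
    formMatrix x L = wedgeTranspose A (A.map OneForm.bar) ↔
      dualNakanoMatrix L = (coeffMatrix A)ᴴ * coeffMatrix A := by
  have hentry : ∀ j i, wedgeTranspose A (A.map OneForm.bar) j i =
      form11 x fun α β => ((coeffMatrix A)ᴴ * coeffMatrix A) (i, β) (j, α) := fun j i => by
    simp only [wedgeTranspose, of_apply, map_apply, (hA _ _).wedge_bar (hA _ _), form11_sum,
      coeffMatrix, mul_apply, conjTranspose_apply, RCLike.star_def, mul_comm]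
  simp only [← Matrix.ext_iff, hentry, formMatrix, of_apply, form11_injective.eq_iff, funext_iff,
    Prod.forall, dualNakanoMatrix]
  exact ⟨fun h i β j α => h j i α β, fun h j i α β => h i β j α⟩

lemma posDef_dualNakanoMatrix_iff_exists_wedge (x : X) :
    (dualNakanoMatrix L).PosDef ↔
      ∃ (N : ℕ) (A : Matrix (Fin r) (Fin N) (OneForm n x)), (∀ j p, (A j p).IsType10) ∧
        formMatrix x L = wedgeTranspose A (A.map OneForm.bar) ∧
        (coeffMatrix A).rank = r * n := by
  have hcard : Fintype.card (Fin r × Fin n) = r * n := by simp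
  constructor
  · intro hL
    obtain ⟨C, hC⟩ := exists_eq_conjTranspose_mul_self hL.posSemidef
    choose A hA hAC using fun j p => OneForm.exists_isType10_coeff_eq x fun α => C p (j, α)
    have hcoeff : coeffMatrix (of A) = C := by
      ext p ⟨j, α⟩
      exact congrFun (hAC j p) α
    refine ⟨_, of A, hA, ?_, ?_⟩
    · rw [formMatrix_eq_wedgeTranspose_iff (A := of A) hA, hcoeff, hC]
    · rwa [hcoeff, ← hcard, ← posDef_conjTranspose_mul_self_iff_rank, ← hC]
  · rintro ⟨N, A, hA, hL, hrank⟩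
    rw [(formMatrix_eq_wedgeTranspose_iff hA).mp hL, posDef_conjTranspose_mul_self_iff_rank, hrank,
      hcard]

lemma wedgeTranspose_map_bar (B : Matrix (Fin r) (Fin N) (OneForm n x)) :
    wedgeTranspose (B.map OneForm.bar) ((B.map OneForm.bar).map OneForm.bar) =
      (-wedgeTranspose B (B.map OneForm.bar))ᵀ := by
  ext1 i j
  simp only [wedgeTranspose, of_apply, map_apply, OneForm.bar_involutive _, transpose_apply,
    Matrix.neg_apply, ← Finset.sum_neg_distrib, OneForm.neg_wedge]

lemma rank_coeffMatrix_map_bar (B : Matrix (Fin r) (Fin N) (OneForm n x)) :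
    (coeffMatrix (B.map OneForm.bar)).rank = (coeffMatrix B).rank :=
  (rank_transpose _).symm.trans (rank_conjTranspose (coeffMatrix B))

lemma posDef_nakanoMatrix_iff_exists_wedge (x : X) :
    (nakanoMatrix L).PosDef ↔
      ∃ (N : ℕ) (B : Matrix (Fin r) (Fin N) (OneForm n x)), (∀ j p, (B j p).IsType01) ∧
        formMatrix x L = -wedgeTranspose B (B.map OneForm.bar) ∧
        (coeffMatrix B).rank = r * n := by
  have hbar (N : ℕ) : Function.Involutive
      fun B : Matrix (Fin r) (Fin N) (OneForm n x) => B.map OneForm.bar :=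
    fun B => Matrix.ext fun j p => OneForm.bar_involutive (B j p)
  have htranspose : formMatrix x (fun α β => (L α β)ᵀ) = (formMatrix x L)ᵀ := rfl
  refine (posDef_dualNakanoMatrix_iff_exists_wedge x).trans <| exists_congr fun N =>
    (hbar N).surjective.exists.trans ?_
  simp only [map_apply, OneForm.isType10_bar_iff, htranspose, wedgeTranspose_map_bar,
    transpose_inj, rank_coeffMatrix_map_bar]

end Forms

section Positivity

variable {n r : ℕ} {X : Type*} [TopologicalSpace X] [ChartedSpace (Cn n) X]
  {E : X → Type*} [TopologicalSpace (Bundle.TotalSpace (Cn r) E)]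
  [∀ x, AddCommGroup (E x)] [∀ x, Module ℂ (E x)] [∀ x, TopologicalSpace (E x)]
  [FiberBundle (Cn r) E]

namespace HermitianMetric

variable {h : HermitianMetric n r E}

lemma nakanoPositive_iff : h.NakanoPositive ↔
    ∀ (x : X) (e : Fin r → Π y : X, E y), IsHolFrameNear n r E x e →
      (nakanoMatrix (h.lowerMatrix e x)).PosDef := by
  simp only [posDef_prod_iff]
  refine forall₅_congr fun x e _ u _ => ?_
  rw [Finset.sum_comm]
  rfl

lemma dualNakanoPositive_iff : h.DualNakanoPositive ↔
    ∀ (x : X) (e : Fin r → Π y : X, E y), IsHolFrameNear n r E x e →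
      (dualNakanoMatrix (h.lowerMatrix e x)).PosDef := by
  simp only [posDef_prod_iff]
  rfl

lemma IsUnitaryAt.formMatrix_lowerMatrix {e : Fin r → Π y : X, E y} {x : X}
    (hu : h.IsUnitaryAt e x) : formMatrix x (h.lowerMatrix e x) = h.curvatureMatrix e x := by
  have hform : ∀ i j, h.form x (e i x) (e j x) = if i = j then 1 else 0 := hu
  simp only [formMatrix, lowerMatrix, Matrix.of_apply, curvatureLower, hform, mul_ite, mul_one,
    mul_zero, Finset.sum_ite_eq', Finset.mem_univ, if_true]
  rfl

end HermitianMetric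

end Positivity

end

theorem corollary4p2 (n r : ℕ) {X : Type*} [TopologicalSpace X] [ChartedSpace (Cn n) X]
    [IsManifold 𝓘(ℂ, Cn n) ω X]
    (E : X → Type*) [TopologicalSpace (Bundle.TotalSpace (Cn r) E)]
    [∀ x, AddCommGroup (E x)] [∀ x, Module ℂ (E x)] [∀ x, TopologicalSpace (E x)]
    [FiberBundle (Cn r) E] [VectorBundle ℂ (Cn r) E]
    [ContMDiffVectorBundle ω (Cn r) E 𝓘(ℂ, Cn n)]
    (h : HermitianMetric n r E) :
    (h.NakanoPositive ↔
      ∀ x : X, ∃ e : Fin r → Π y : X, E y, IsHolFrameNear n r E x e ∧ h.IsUnitaryAt e x ∧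
        ∃ (N : ℕ) (B : Matrix (Fin r) (Fin N) (OneForm n x)),
          (∀ j p, (B j p).IsType01) ∧
          h.curvatureMatrix e x = -wedgeTranspose B (B.map OneForm.bar) ∧
          (coeffMatrix B).rank = r * n) ∧
    (h.DualNakanoPositive ↔
      ∀ x : X, ∃ e : Fin r → Π y : X, E y, IsHolFrameNear n r E x e ∧ h.IsUnitaryAt e x ∧
        ∃ (N : ℕ) (A : Matrix (Fin r) (Fin N) (OneForm n x)),
          (∀ j p, (A j p).IsType10) ∧
          h.curvatureMatrix e x = wedgeTranspose A (A.map OneForm.bar) ∧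
          (coeffMatrix A).rank = r * n) := by
  refine ⟨h.nakanoPositive_iff.trans <|
      (h.forall_frame_iff_exists_unitary FrameCongruent.posDef_nakanoMatrix_iff).trans ?_,
    h.dualNakanoPositive_iff.trans <|
      (h.forall_frame_iff_exists_unitary FrameCongruent.posDef_dualNakanoMatrix_iff).trans ?_⟩
  · refine forall_congr' fun x => exists_congr fun e => and_congr_right fun _ =>
      and_congr_right fun hu => ?_
    rw [← hu.formMatrix_lowerMatrix]
    exact posDef_nakanoMatrix_iff_exists_wedge x
  · refine forall_congr' fun x => exists_congr fun e => and_congr_right fun _ =>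
      and_congr_right fun hu => ?_
    rw [← hu.formMatrix_lowerMatrix]
    exact posDef_dualNakanoMatrix_iff_exists_wedge x
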